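/- For real numbers $0<\beta<\alpha<1$ let $T_{\alpha,\beta}:[0,1)\to[0,1)$ be the interval translation map $$T_{\alpha,\beta}(x)=\begin{cases} x+\alpha, & x\in[0,1-\alpha),\\ x+\beta, & x\in[1-\alpha,1-\beta),\\ x+\beta-1, & x\in[1-\beta,1).\end{cases}$$ Put $\Omega_0=[0,1)$ and $\Omega_{n+1}=T_{\alpha,\beta}(\Omega_n)$; $T_{\alpha,\beta}$ is of infinite type if $\Omega_{n+1}\subsetneq\Omega_n$ for every $n\ge 0$. Let $G(\alpha,\beta)=\left(\frac{\beta}{\alpha},\ \frac{\beta-1}{\alpha}+\left\lfloor\frac1\alpha\right\rfloor\right)$, write $(\alpha_i,\beta_i)=G^i(\alpha,\beta)$ for $i\ge 0$, and define the coding sequence of $(\alpha,\beta)$ by $k_i=\lfloor 1/\alpha_i\rfloor$, that is, $\frac1{k_i+1}<\alpha_i\le\frac1{k_i}$ (when $T_{\alpha,\beta}$ is of infinite type, $0<\beta_i<\alpha_i<1$ for all $i$, so that the sequence is well defined). **Theorem.** Let $0<\beta<\alpha<1$ and let $T_{\alpha,\beta}$ be of infinite type with coding sequence $(k_i)_{i\ge0}$.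 If for some real $\lambda>1$ one has $k_i\ge\lambda k_{i-1}$ for all sufficiently large $i$, then $T_{\alpha,\beta}$ is not uniquely ergodic: it has invariant Borel probability measures on $[0,1)$, and more than one of them. -/

import Mathlib

open MeasureTheory Filter

noncomputable section

namespace ITM

/-- The open parameter triangle `0 < β < α < 1`. -/
def IsParam (α β : ℝ) : Prop := 0 < β ∧ β < α ∧ α < 1

/-- The formula of the interval translation map with parameters `α, β`; only its values on
`[0, 1)` matter. -/
def mapReal (α β x : ℝ) : ℝ :=
  if x < 1 - α then x + α
  else if x < 1 - β then x + β
  else x + β - 1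

theorem mapsTo_mapReal {α β : ℝ} (h : IsParam α β) :
    Set.MapsTo (mapReal α β) (Set.Ico 0 1) (Set.Ico 0 1) := by
  obtain ⟨h1, h2, h3⟩ := h
  intro x hx
  obtain ⟨hx0, hx1⟩ := hx
  unfold mapReal
  split_ifs with ha hb
  · constructor <;> linarith
  · constructor <;> linarith
  · constructor <;> linarith

/-- The interval translation map `T_{α,β} : [0,1) → [0,1)`. -/
def T {α β : ℝ} (h : IsParam α β) : Set.Ico (0 : ℝ) 1 → Set.Ico (0 : ℝ) 1 :=
  (mapsTo_mapReal h).restrict (mapReal α β) (Set.Ico 0 1) (Set.Ico 0 1)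

/-- The nested images `Ω_0 = [0,1)`, `Ω_{n+1} = T(Ω_n)`. -/
def Omega {X : Type*} (f : X → X) : ℕ → Set X
  | 0 => Set.univ
  | n + 1 => f '' Omega f n

/-- `f` is of infinite type if `Ω_{n+1}` is strictly smaller than `Ω_n` for every `n`. -/
def InfiniteType {X : Type*} (f : X → X) : Prop := ∀ n, Omega f (n + 1) ⊂ Omega f n

/-- The Gauss map `G(α, β) = (β/α, (β-1)/α + ⌊1/α⌋)`. -/
def gauss (p : ℝ × ℝ) : ℝ × ℝ :=
  (p.2 / p.1, (p.2 - 1) / p.1 + (⌊1 / p.1⌋ : ℝ))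

/-- The coding sequence of `(α, β)`: `k_i = ⌊1/α_i⌋` where `(α_i, β_i) = G^i(α, β)`,
that is, `k_i = j` when `1/(j+1) < α_i ≤ 1/j`. -/
def coding (α β : ℝ) (i : ℕ) : ℕ := ⌊1 / (gauss^[i] (α, β)).1⌋₊

/-- `μ` is a Borel probability measure invariant under `f`. -/
def IsInvariantProbability {X : Type*} [MeasurableSpace X] (f : X → X) (μ : Measure X) : Prop :=
  IsProbabilityMeasure μ ∧ MeasurePreserving f μ μ

/-- `f` is uniquely ergodic if it has exactly one invariant Borel probability measure. -/
def UniquelyErgodic {X : Type*} [MeasurableSpace X] (f : X → X) : Prop :=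
  ∃! μ : Measure X, IsInvariantProbability f μ

end ITM

end

/-!
# Interval translation maps with fast growing coding are not uniquely ergodic

Write `T` for the map with parameters `α, β` and `k = ⌊1/α⌋`. On the end segment `[1 - α, 1)`, `T`
induces a rescaled copy of the map with parameters `G(α, β)` (`IsTower.gauss`): if `A, B, C` stand
for the orbit segments that start in the three intervals of continuity, those of the induced map are
`B`, `C Aᵏ`, `C Aᵏ⁻¹`. If the induced map is of finite type, so is `T`, and on or beyond the
boundary of the parameter range the induced map is eventually an interval exchange; hence for `T` of
infinite type all pairs `Gⁱ(α, β)` are parameters (`isParam_iterate_gauss`).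

Let `a i` be the length of the orbit segment `A` at level `i`. The substitution gives
`a (i + 2) = k i * a i + c i` with `c i ≤ a (i + 1)`, and exponential growth of `k` makes the ratios
`a i / a (i + 1)` summable (`summable_height_ratio`). For a function that is constant on the three
intervals, the Birkhoff averages along the segments `A` therefore move little from level `i` to
level `i + 2`, with summable total drift. Since substitution steps are invertible over the reals,
the function can be chosen such that at some late levels `I` and `I + 1` the averages are `1` and
`0`; then they stay above `2/3` at the levels `I + 2n` and below `1/3` at the levels `I + 2n + 1`
(`exists_freq_gap`).

Each of the two families of orbit segments yields an invariant measure. Limits of Birkhoff averages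
along an ultrafilter form a finitely additive invariant mean. Every orbit enters the end segments
`[1 - l, 1)` with `l` arbitrarily small, so there are no periodic points; as a fixed iterate has
only finitely many displacements, two visits to a short interval are far apart in time, and short
intervals have small mean. The distribution function of the mean is therefore continuous, and its
Stieltjes measure is an invariant probability measure
(`IsInvariantMean.exists_isInvariantProbability`). The two measures integrate the chosen function
differently.
-/

namespace ITM

/-! ### Renormalization of the map and of its orbit segments -/

/-- The function taking the values `v.1`, `v.2.1`, `v.2.2` on the three intervals
`[0, 1 - α)`, `[1 - α, 1 - β)`, `[1 - β, 1)` on which the map with parameters `α, β` is a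
translation. -/
noncomputable def piece {M : Type*} (α β : ℝ) (v : M × M × M) (y : ℝ) : M :=
  if y < 1 - α then v.1 else if y < 1 - β then v.2.1 else v.2.2

/-- The affine map of `[0, 1)` onto its right end segment `[1 - l, 1)` of length `l`. -/
def zoom (l y : ℝ) : ℝ := 1 - l + l * y

theorem zoom_mem {l y : ℝ} (hl : 0 < l) (hl1 : l ≤ 1) (hy : y ∈ Set.Ico (0 : ℝ) 1) :
    zoom l y ∈ Set.Ico (0 : ℝ) 1 := by
  obtain ⟨h0, h1⟩ := hy
  unfold zoom
  constructor <;> nlinarith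

theorem zoom_zoom (l a y : ℝ) : zoom l (zoom a y) = zoom (l * a) y := by
  unfold zoom; ring

/-- The action on triples of the substitution `A ↦ B`, `B ↦ C Aᵏ`, `C ↦ C Aᵏ⁻¹`, which records how
orbit segments of a renormalized map are composed of orbit segments of the original one. The
triple holds the lengths, or the Birkhoff sums, of the three segments. -/
def substStep {M : Type*} [AddCommMonoid M] (k : ℕ) (v : M × M × M) : M × M × M :=
  (v.2.1, v.2.2 + k • v.1, v.2.2 + (k - 1) • v.1)

/-- The orbit segment of `F` of length `n` that starts at `x` ends at `y`, and the Birkhoff sum of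
`g` along it is `s`. -/
def Passage (F g : ℝ → ℝ) (n : ℕ) (s x y : ℝ) : Prop :=
  F^[n] x = y ∧ birkhoffSum F g n x = s

theorem Passage.trans {F g : ℝ → ℝ} {m n : ℕ} {s t x y z : ℝ} (h : Passage F g m s x y)
    (h' : Passage F g n t y z) : Passage F g (m + n) (s + t) x z := by
  obtain ⟨rfl, rfl⟩ := h
  obtain ⟨rfl, rfl⟩ := h'
  exact ⟨by rw [add_comm, Function.iterate_add_apply], birkhoffSum_add F g m n x⟩

/-- `F` induces the map with parameters `α, β` on a copy of `[0, 1)` embedded by `φ`: the orbit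
segment from `φ y` to `φ (mapReal α β y)` has its length given by `v`, and its Birkhoff sum of `g`
by `w`, according to the interval of continuity that contains `y`. The return to the copy need not
be the first one. -/
def IsTower (F g φ : ℝ → ℝ) (α β : ℝ) (v : ℕ × ℕ × ℕ) (w : ℝ × ℝ × ℝ) : Prop :=
  ∀ y ∈ Set.Ico (0 : ℝ) 1,
    Passage F g (piece α β v y) (piece α β w y) (φ y) (φ (mapReal α β y))

theorem isTower_self (α β : ℝ) (w : ℝ × ℝ × ℝ) :
    IsTower (mapReal α β) (piece α β w) id α β (1, 1, 1) w := by
  intro y _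
  have : piece α β (1, 1, 1) y = 1 := by simp [piece]
  rw [this]
  exact ⟨rfl, birkhoffSum_one _ _ _⟩

/-- Several consecutive translations by `α`, made on the interval `[0, 1 - α)`. -/
theorem IsTower.passage_add_mul {F g φ : ℝ → ℝ} {α β : ℝ} {v : ℕ × ℕ × ℕ} {w : ℝ × ℝ × ℝ}
    (h : IsTower F g φ α β v w) (hα : 0 < α) {z : ℝ} (hz : 0 ≤ z) (n : ℕ) (hn : z + n * α < 1) :
    Passage F g (n • v.1) (n • w.1) (φ z) (φ (z + n * α)) := by
  induction n with
  | zero => simp [Passage]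
  | succ n ih =>
    push_cast at hn ⊢
    have h0 : 0 ≤ n * α := by positivity
    have h1 : z + n * α < 1 - α := by linarith
    have h2 := h (z + n * α) ⟨by linarith, by linarith⟩
    simp only [piece, mapReal, if_pos h1] at h2
    have h3 := (ih (by linarith)).trans h2
    rwa [← succ_nsmul, ← succ_nsmul, show z + n * α + α = z + (n + 1) * α by ring] at h3

theorem exists_nat_add_mul_mem {α x : ℝ} (hα : 0 < α) (hx : x ∈ Set.Ico (0 : ℝ) 1) :
    ∃ j ≤ ⌈1 / α⌉₊, x + j * α ∈ Set.Ico (1 - α) 1 := by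
  obtain ⟨hx0, hx1⟩ := hx
  rcases le_or_gt (1 - α) x with h | h
  · exact ⟨0, Nat.zero_le _, by simpa using h, by simpa using hx1⟩
  · refine ⟨⌈(1 - α - x) / α⌉₊, Nat.ceil_mono ?_, ?_, ?_⟩
    · gcongr; linarith
    · have := Nat.le_ceil ((1 - α - x) / α)
      rw [div_le_iff₀ hα] at this
      linarith
    · have := Nat.ceil_lt_add_one (a := (1 - α - x) / α) (div_nonneg (by linarith) hα.le)
      have h2 := mul_lt_mul_of_pos_right this hα
      rw [add_mul, div_mul_cancel₀ _ hα.ne'] at h2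
      linarith

/-- Every orbit enters the segment `[1 - α, 1)`, after a bounded time. -/
theorem exists_iterate_eq_zoom {α β : ℝ} (hα : 0 < α) {x : ℝ}
    (hx : x ∈ Set.Ico (0 : ℝ) 1) :
    ∃ j ≤ ⌈1 / α⌉₊, ∃ y ∈ Set.Ico (0 : ℝ) 1, (mapReal α β)^[j] x = zoom α y := by
  obtain ⟨j, hj, h1, h2⟩ := exists_nat_add_mul_mem hα hx
  refine ⟨j, hj, (x + j * α - (1 - α)) / α, ⟨div_nonneg (by linarith) hα.le, ?_⟩, ?_⟩
  · rw [div_lt_one hα]; linarith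
  · have := ((isTower_self α β 0).passage_add_mul hα hx.1 j h2).1
    simp only [id, smul_eq_mul, mul_one] at this
    rw [this, zoom]
    field_simp
    ring

theorem IsParam.one_le_floor {α β : ℝ} (h : IsParam α β) : 1 ≤ ⌊1 / α⌋₊ := by
  obtain ⟨h1, h2, h3⟩ := h
  rw [Nat.one_le_floor_iff, le_div_iff₀ (by linarith)]
  linarith

/-- The two coordinates of the Gauss map, cleared of denominators. -/
theorem IsParam.mul_gauss {α β : ℝ} (h : IsParam α β) :
    α * (gauss (α, β)).1 = β ∧ α * (gauss (α, β)).2 = β - 1 + ⌊1 / α⌋₊ * α := by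
  obtain ⟨h1, h2, h3⟩ := h
  have hα : 0 < α := by linarith
  rw [gauss, natCast_floor_eq_intCast_floor (by positivity)]
  constructor <;> field_simp

theorem IsParam.gauss_bounds {α β : ℝ} (h : IsParam α β) :
    0 < (gauss (α, β)).1 ∧ (gauss (α, β)).1 < 1 ∧ (gauss (α, β)).2 ≤ (gauss (α, β)).1 ∧
      (gauss (α, β)).1 - 1 < (gauss (α, β)).2 := by
  obtain ⟨e1, e2⟩ := h.mul_gauss
  obtain ⟨h1, h2, h3⟩ := h
  have hα : 0 < α := by linarith
  have k1 : (⌊1 / α⌋₊ : ℝ) * α ≤ 1 := by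
    rw [← le_div_iff₀ hα]; exact Nat.floor_le (by positivity)
  have k2 : 1 < ((⌊1 / α⌋₊ : ℝ) + 1) * α := by
    rw [← div_lt_iff₀ hα]; exact Nat.lt_floor_add_one _
  refine ⟨?_, ?_, ?_, ?_⟩
  · rw [← mul_lt_mul_iff_right₀ hα]; linarith
  · rw [← mul_lt_mul_iff_right₀ hα]; linarith
  · rw [← mul_le_mul_iff_right₀ hα]; linarith
  · rw [← mul_lt_mul_iff_right₀ hα]; linarith

/-- Renormalization: the map with parameters `G(α, β)` is induced on the segment `[1 - α, 1)`.
A point of that segment below `1 - β` returns at once, and any other point is sent to `[0, β)` and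
then climbs back by steps of length `α`. -/
theorem IsTower.gauss {F g φ : ℝ → ℝ} {α β : ℝ} {v : ℕ × ℕ × ℕ} {w : ℝ × ℝ × ℝ}
    (h : IsTower F g φ α β v w) (hp : IsParam α β) :
    IsTower F g (fun y => φ (zoom α y)) (ITM.gauss (α, β)).1 (ITM.gauss (α, β)).2
      (substStep ⌊1 / α⌋₊ v) (substStep ⌊1 / α⌋₊ w) := by
  obtain ⟨e1, e2⟩ := hp.mul_gauss
  obtain ⟨g1, g2, g3, g4⟩ := hp.gauss_bounds
  have hk := hp.one_le_floor
  obtain ⟨h1, h2, h3⟩ := hp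
  set α' := (ITM.gauss (α, β)).1
  set β' := (ITM.gauss (α, β)).2
  set k := ⌊1 / α⌋₊
  have hα : 0 < α := by linarith
  rintro y ⟨hy0, hy1⟩
  have m1 := mul_lt_mul_of_pos_left hy1 hα
  have m0 := mul_nonneg hα.le hy0
  have hz := h (zoom α y) (by unfold zoom; constructor <;> linarith)
  have hA : ¬ zoom α y < 1 - α := by unfold zoom; linarith
  simp only [piece, mapReal, if_neg hA] at hz
  simp only [piece, mapReal, substStep]
  by_cases hB : y < 1 - α'
  · have m2 := mul_lt_mul_of_pos_left hB hα
    have hB' : zoom α y < 1 - β := by unfold zoom; linarith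
    simp only [if_pos hB'] at hz
    simp only [if_pos hB]
    rwa [show zoom α (y + α') = zoom α y + β by unfold zoom; linarith]
  · have m2 := mul_le_mul_of_nonneg_left (not_lt.1 hB) hα.le
    have hB' : ¬ zoom α y < 1 - β := by unfold zoom; linarith
    simp only [if_neg hB'] at hz
    simp only [if_neg hB]
    have hz0 : 0 ≤ zoom α y + β - 1 := by linarith
    by_cases hC : y < 1 - β'
    · have m3 := mul_lt_mul_of_pos_left hC hα
      simp only [if_pos hC]
      have e : zoom α (y + β') = zoom α y + β - 1 + k * α := by unfold zoom; linarith
      rw [e]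
      refine hz.trans (h.passage_add_mul hα hz0 k ?_)
      rw [← e]; unfold zoom; linarith
    · simp only [if_neg hC]
      have e : zoom α (y + β' - 1) = zoom α y + β - 1 + (k - 1 : ℕ) * α := by
        rw [Nat.cast_pred hk]; unfold zoom; linarith
      rw [e]
      refine hz.trans (h.passage_add_mul hα hz0 (k - 1) ?_)
      have m4 : α * (y + β' - 1) < α * 1 := mul_lt_mul_of_pos_left (by linarith) hα
      rw [← e]; unfold zoom; linarith

/-! ### Finite type passes down from the renormalized map -/

/-- All orbits of the map are absorbed, within a common time, by a set that is contained in its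
own image. -/
def FiniteType (α β : ℝ) : Prop :=
  ∃ K ⊆ Set.Ico (0 : ℝ) 1, ∃ n : ℕ, K ⊆ mapReal α β '' K ∧
    ∀ y ∈ Set.Ico (0 : ℝ) 1, (mapReal α β)^[n] y ∈ K

theorem coe_iterate_T {α β : ℝ} (h : IsParam α β) (n : ℕ) (x : Set.Ico (0 : ℝ) 1) :
    (((T h)^[n] x : Set.Ico (0 : ℝ) 1) : ℝ) = (mapReal α β)^[n] x :=
  Function.Semiconj.iterate_right (f := ((↑) : Set.Ico (0 : ℝ) 1 → ℝ)) (ga := T h)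
    (gb := mapReal α β) (fun _ => rfl) n x

theorem Omega_eq_range {X : Type*} (f : X → X) (n : ℕ) : Omega f n = Set.range f^[n] := by
  induction n with
  | zero => simp [Omega]
  | succ n ih => rw [Omega, ih, Function.iterate_succ', Set.range_comp]

theorem not_finiteType {α β : ℝ} (h : IsParam α β) (hinf : InfiniteType (T h)) :
    ¬ FiniteType α β := by
  rintro ⟨K, hK, n, hKs, hKn⟩
  have key : ∀ m, (((↑) : Set.Ico (0 : ℝ) 1 → ℝ) ⁻¹' K) ⊆ Omega (T h) m := by
    intro m
    induction m with
    | zero => exact Set.subset_univ _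
    | succ m ih =>
      rintro ⟨x, hx⟩ hxK
      obtain ⟨y, hyK, hyx⟩ := hKs hxK
      exact ⟨⟨y, hK hyK⟩, ih hyK, Subtype.ext hyx⟩
  refine (hinf n).2 (Set.Subset.trans ?_ (key (n + 1)))
  rw [Omega_eq_range]
  rintro _ ⟨x, rfl⟩
  change (((T h)^[n] x : Set.Ico (0 : ℝ) 1) : ℝ) ∈ K
  rw [coe_iterate_T]
  exact hKn _ x.2

theorem FiniteType.of_gauss {α β : ℝ} (hp : IsParam α β)
    (h : FiniteType (gauss (α, β)).1 (gauss (α, β)).2) : FiniteType α β := by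
  obtain ⟨K, hK, n, hKs, hKn⟩ := h
  have hα : 0 < α := by linarith [hp.1, hp.2.1]
  have hα1 : α < 1 := hp.2.2
  have ht := (isTower_self α β 0).gauss hp
  obtain ⟨g1, g2, g3, g4⟩ := hp.gauss_bounds
  have hk := hp.one_le_floor
  have hmaps := mapsTo_mapReal hp
  set f := mapReal α β with hf
  set α' := (gauss (α, β)).1
  set β' := (gauss (α, β)).2
  set k := ⌊1 / α⌋₊
  set τ : ℝ → ℕ := piece α' β' (substStep k (1, 1, 1)) with hτ
  have hτ1 : ∀ y, 1 ≤ τ y ∧ τ y ≤ k + 1 := by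
    intro y
    simp only [hτ, piece, substStep, smul_eq_mul, mul_one]
    split_ifs <;> omega
  have hret : ∀ y ∈ Set.Ico (0 : ℝ) 1, f^[τ y] (zoom α y) = zoom α (mapReal α' β' y) :=
    fun y hy => (ht y hy).1
  have hmaps' : Set.MapsTo (mapReal α' β') (Set.Ico 0 1) (Set.Ico 0 1) := by
    rintro y ⟨hy0, hy1⟩
    unfold mapReal
    split_ifs <;> constructor <;> linarith
  have hiter : ∀ y ∈ Set.Ico (0 : ℝ) 1, ∀ m : ℕ, ∃ t ≤ m * (k + 1),
      f^[t] (zoom α y) = zoom α ((mapReal α' β')^[m] y) := by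
    intro y hy m
    induction m with
    | zero => exact ⟨0, Nat.zero_le _, rfl⟩
    | succ m ih =>
      obtain ⟨t, ht1, ht2⟩ := ih
      refine ⟨τ ((mapReal α' β')^[m] y) + t, ?_, ?_⟩
      · have := (hτ1 ((mapReal α' β')^[m] y)).2
        rw [Nat.succ_mul]
        omega
      · rw [Function.iterate_add_apply, ht2, hret _ (hmaps'.iterate m hy),
          Function.iterate_succ_apply']
  -- The orbits of the absorbing set of the renormalized map form the absorbing set.
  refine ⟨{x | ∃ y ∈ K, ∃ j, f^[j] (zoom α y) = x}, ?_, ⌈1 / α⌉₊ + n * (k + 1), ?_, ?_⟩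
  · rintro _ ⟨y, hy, j, rfl⟩
    exact hmaps.iterate j (zoom_mem hα hα1.le (hK hy))
  · rintro _ ⟨y, hy, j, rfl⟩
    cases j with
    | zero =>
      obtain ⟨z, hz, rfl⟩ := hKs hy
      refine ⟨f^[τ z - 1] (zoom α z), ⟨z, hz, _, rfl⟩, ?_⟩
      rw [← hf, ← Function.iterate_succ_apply' f, Nat.succ_eq_add_one, Nat.sub_add_cancel (hτ1 z).1]
      exact hret z (hK hz)
    | succ j => exact ⟨f^[j] (zoom α y), ⟨y, hy, j, rfl⟩, (Function.iterate_succ_apply' f j _).symm⟩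
  · intro x hx
    obtain ⟨j, hj, y, hy, hjy⟩ := exists_iterate_eq_zoom (β := β) hα hx
    obtain ⟨t, ht1, ht2⟩ := hiter y hy n
    refine ⟨_, hKn y hy, ⌈1 / α⌉₊ + n * (k + 1) - (j + t), ?_⟩
    rw [← ht2, ← hjy, ← Function.iterate_add_apply, ← Function.iterate_add_apply]
    exact congrArg (fun m => f^[m] x) (by omega)

/-- On the boundary of the parameter range, or beyond it, the renormalized map is eventually an
exchange of two intervals. -/
theorem finiteType_of_not_isParam {α β : ℝ} (h0 : 0 < α) (h1 : α < 1) (h2 : β ≤ α)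
    (h3 : α - 1 < β) (hn : ¬ IsParam α β) : FiniteType α β := by
  have hβ : β = α ∨ β ≤ 0 := by
    by_contra! hc
    exact hn ⟨hc.2, lt_of_le_of_ne h2 hc.1, h1⟩
  rcases hβ with rfl | hβ
  · refine ⟨Set.Ico 0 1, subset_rfl, 0, ?_, fun y hy => hy⟩
    rintro z ⟨hz0, hz1⟩
    rcases le_or_gt β z with hz | hz
    · exact ⟨z - β, ⟨by linarith, by linarith⟩, by rw [mapReal, if_pos (by linarith)]; ring⟩
    · refine ⟨z + 1 - β, ⟨by linarith, by linarith⟩, ?_⟩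
      rw [mapReal, if_neg (by linarith), if_neg (by linarith)]
      ring
  · have hmaps : Set.MapsTo (mapReal α β) (Set.Ico (1 - α + β) 1) (Set.Ico (1 - α + β) 1) := by
      rintro y ⟨hy0, hy1⟩
      unfold mapReal
      split_ifs <;> constructor <;> linarith
    refine ⟨Set.Ico (1 - α + β) 1, Set.Ico_subset_Ico_left (by linarith), ⌈1 / α⌉₊, ?_, ?_⟩
    · rintro z ⟨hz0, hz1⟩
      rcases le_or_gt (1 + β) z with hz | hz
      · exact ⟨z - α, ⟨by linarith, by linarith⟩, by rw [mapReal, if_pos (by linarith)]; ring⟩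
      · refine ⟨z - β, ⟨by linarith, by linarith⟩, ?_⟩
        rw [mapReal, if_neg (by linarith), if_pos (by linarith)]
        ring
    · intro x hx
      obtain ⟨j, hj, y, hy, hjy⟩ := exists_iterate_eq_zoom (β := β) h0 hx
      rw [← Nat.sub_add_cancel hj, Function.iterate_add_apply, hjy]
      refine hmaps.iterate _ ⟨?_, ?_⟩
      · have := mul_nonneg h0.le hy.1
        unfold zoom; linarith
      · have := mul_lt_mul_of_pos_left hy.2 h0
        unfold zoom; linarith

theorem isParam_iterate_gauss {α β : ℝ} (h : IsParam α β) (hinf : InfiniteType (T h)) (i : ℕ) :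
    IsParam (gauss^[i] (α, β)).1 (gauss^[i] (α, β)).2 := by
  suffices H : IsParam (gauss^[i] (α, β)).1 (gauss^[i] (α, β)).2 ∧
      ¬ FiniteType (gauss^[i] (α, β)).1 (gauss^[i] (α, β)).2 from H.1
  induction i with
  | zero => exact ⟨h, not_finiteType h hinf⟩
  | succ i ih =>
    obtain ⟨hp, hf⟩ := ih
    rw [Function.iterate_succ_apply']
    have hf' := fun hc => hf (FiniteType.of_gauss hp hc)
    obtain ⟨g1, g2, g3, g4⟩ := hp.gauss_bounds
    exact ⟨by_contra fun hc => hf' (finiteType_of_not_isParam g1 g2 g3 g4 hc), hf'⟩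

/-! ### Iterated renormalization -/

/-- The triples obtained from `v` by the substitution steps with parameters `k 0, k 1, …`. -/
def substSeq {M : Type*} [AddCommMonoid M] (k : ℕ → ℕ) (v : M × M × M) : ℕ → M × M × M
  | 0 => v
  | i + 1 => substStep (k i) (substSeq k v i)

/-- The length of the segment of `[0, 1)` on which the `i`-th renormalization takes place. -/
noncomputable def scale (α β : ℝ) (i : ℕ) : ℝ :=
  ∏ j ∈ Finset.range i, (gauss^[j] (α, β)).1

section Renormalizable

variable {α β : ℝ} (hP : ∀ i, IsParam (gauss^[i] (α, β)).1 (gauss^[i] (α, β)).2)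
include hP

theorem scale_mem (i : ℕ) : 0 < scale α β i ∧ scale α β i ≤ 1 := by
  have h : ∀ j, 0 < (gauss^[j] (α, β)).1 ∧ (gauss^[j] (α, β)).1 < 1 := fun j => by
    obtain ⟨h1, h2, h3⟩ := hP j
    exact ⟨by linarith, h3⟩
  exact ⟨Finset.prod_pos fun j _ => (h j).1,
    Finset.prod_le_one (fun j _ => (h j).1.le) fun j _ => (h j).2.le⟩

theorem isTower_scale (w : ℝ × ℝ × ℝ) (i : ℕ) :
    IsTower (mapReal α β) (piece α β w) (zoom (scale α β i))
      (gauss^[i] (α, β)).1 (gauss^[i] (α, β)).2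
      (substSeq (coding α β) (1, 1, 1) i) (substSeq (coding α β) w i) := by
  induction i with
  | zero =>
    have : zoom (scale α β 0) = id := by funext y; simp [zoom, scale]
    rw [this]
    exact isTower_self α β w
  | succ i ih =>
    have h := ih.gauss (hP i)
    simp only [zoom_zoom] at h
    rw [Function.iterate_succ_apply', scale, Finset.prod_range_succ]
    exact h

/-- Every orbit enters each of the segments `[1 - scale α β i, 1)`. -/
theorem exists_iterate_eq_zoom_scale (i : ℕ) {x : ℝ} (hx : x ∈ Set.Ico (0 : ℝ) 1) :
    ∃ j, ∃ y ∈ Set.Ico (0 : ℝ) 1, (mapReal α β)^[j] x = zoom (scale α β i) y := by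
  induction i with
  | zero => exact ⟨0, x, hx, by simp [zoom, scale]⟩
  | succ i ih =>
    obtain ⟨j, y, hy, hj⟩ := ih
    have hp := hP i
    have hα : 0 < (gauss^[i] (α, β)).1 := hp.1.trans hp.2.1
    obtain ⟨m, -, z, hz, hm⟩ := exists_iterate_eq_zoom (β := (gauss^[i] (α, β)).2) hα hy
    have hiter : ∀ m : ℕ, ∃ t, (mapReal α β)^[t] (zoom (scale α β i) y) =
        zoom (scale α β i) ((mapReal (gauss^[i] (α, β)).1 (gauss^[i] (α, β)).2)^[m] y) := by
      intro m
      induction m with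
      | zero => exact ⟨0, rfl⟩
      | succ m ih =>
        obtain ⟨t, ht⟩ := ih
        have := (isTower_scale hP 0 i _ ((mapsTo_mapReal hp).iterate m hy)).1
        rw [← ht, ← Function.iterate_add_apply] at this
        rw [Function.iterate_succ_apply']
        exact ⟨_, this⟩
    obtain ⟨t, ht⟩ := hiter m
    refine ⟨t + j, z, hz, ?_⟩
    rw [Function.iterate_add_apply, hj, ht, hm, zoom_zoom, scale, scale, Finset.prod_range_succ]

theorem one_le_coding (i : ℕ) : 1 ≤ coding α β i := (hP i).one_le_floor

theorem tendsto_scale (hk : Tendsto (fun i => (coding α β i : ℝ)) atTop atTop) :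
    Tendsto (scale α β) atTop (nhds 0) := by
  rw [← tendsto_add_atTop_iff_nat 1]
  refine squeeze_zero (fun i => (scale_mem hP _).1.le) (fun i => ?_) hk.inv_tendsto_atTop
  have hα : 0 < (gauss^[i] (α, β)).1 := (hP i).1.trans (hP i).2.1
  rw [scale, Finset.prod_range_succ, Pi.inv_apply]
  have h1 : (coding α β i : ℝ) ≤ 1 / (gauss^[i] (α, β)).1 := Nat.floor_le (by positivity)
  have h2 : (0 : ℝ) < coding α β i := by exact_mod_cast one_le_coding hP i
  calc _ ≤ 1 * (gauss^[i] (α, β)).1 := by gcongr; exact (scale_mem hP i).2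
    _ ≤ _ := by rw [one_mul, le_inv_comm₀ hα h2, ← one_div]; exact h1

/-- There are no periodic points, since every orbit comes arbitrarily close to `1` from below. -/
theorem iterate_ne_self (hk : Tendsto (fun i => (coding α β i : ℝ)) atTop atTop)
    {x : ℝ} (hx : x ∈ Set.Ico (0 : ℝ) 1) {n : ℕ} (hn : 0 < n) : (mapReal α β)^[n] x ≠ x := by
  intro hper
  have hp : IsParam α β := hP 0
  set f := mapReal α β
  obtain ⟨m, -, hm⟩ := Finset.exists_max_image (Finset.range n) (fun m => f^[m] x)
    ⟨0, Finset.mem_range.2 hn⟩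
  have hlt : 0 < 1 - f^[m] x := by linarith [((mapsTo_mapReal hp).iterate m hx).2]
  obtain ⟨i, hi⟩ := ((tendsto_scale hP hk).eventually_lt_const hlt).exists
  obtain ⟨j, y, hy, hj⟩ := exists_iterate_eq_zoom_scale hP i hx
  have h1 := hm (j % n) (Finset.mem_range.2 (Nat.mod_lt _ hn))
  rw [Function.IsPeriodicPt.iterate_mod_apply hper, hj, zoom] at h1
  have := mul_nonneg (scale_mem hP i).1.le hy.1
  linarith

end Renormalizable

/-! ### Growth of the lengths of the orbit segments -/

section Growth

variable {k : ℕ → ℕ} (hk1 : ∀ i, 1 ≤ k i)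

/-- The lengths `(a, b, c)` of the orbit segments satisfy `1 ≤ a` and `1 ≤ c ≤ b`. -/
theorem substSeq_one_bounds (k : ℕ → ℕ) (i : ℕ) :
    1 ≤ (substSeq k ((1 : ℕ), (1 : ℕ), (1 : ℕ)) i).1 ∧
      1 ≤ (substSeq k ((1 : ℕ), (1 : ℕ), (1 : ℕ)) i).2.2 ∧
      (substSeq k ((1 : ℕ), (1 : ℕ), (1 : ℕ)) i).2.2 ≤
        (substSeq k ((1 : ℕ), (1 : ℕ), (1 : ℕ)) i).2.1 := by
  induction i with
  | zero => simp [substSeq]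
  | succ i ih =>
    obtain ⟨h1, h2, h3⟩ := ih
    simp only [substSeq, substStep]
    refine ⟨h2.trans h3, h2.trans (Nat.le_add_right _ _), ?_⟩
    gcongr
    omega

/-- The length of the first orbit segment at level `i`. -/
def height (k : ℕ → ℕ) (i : ℕ) : ℕ := (substSeq k ((1 : ℕ), (1 : ℕ), (1 : ℕ)) i).1

theorem height_pos (k : ℕ → ℕ) (i : ℕ) : (0 : ℝ) < height k i :=
  Nat.cast_pos.2 (substSeq_one_bounds k i).1

theorem height_add_two (k : ℕ → ℕ) (i : ℕ) :
    (height k (i + 2) : ℝ) =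
      (substSeq k ((1 : ℕ), (1 : ℕ), (1 : ℕ)) i).2.2 + k i * height k i := by
  simp [height, substSeq, substStep]

theorem third_le_height_succ (k : ℕ → ℕ) (i : ℕ) :
    ((substSeq k ((1 : ℕ), (1 : ℕ), (1 : ℕ)) i).2.2 : ℝ) ≤ height k (i + 1) :=
  Nat.cast_le.2 (substSeq_one_bounds k i).2.2

theorem tendsto_height (hk : Tendsto (fun i => (k i : ℝ)) atTop atTop) :
    Tendsto (height k) atTop atTop := by
  rw [← tendsto_natCast_atTop_iff (R := ℝ), ← tendsto_add_atTop_iff_nat 2]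
  refine tendsto_atTop_mono (fun i => ?_) hk
  rw [height_add_two]
  have h1 : (1 : ℝ) ≤ height k i := Nat.one_le_cast.2 (substSeq_one_bounds k i).1
  have h2 : (0 : ℝ) ≤ k i := Nat.cast_nonneg _
  have h3 : (0 : ℝ) ≤ (substSeq k ((1 : ℕ), (1 : ℕ), (1 : ℕ)) i).2.2 := Nat.cast_nonneg _
  nlinarith

variable {lam : ℝ} (hlam : 1 < lam) (hk : ∀ᶠ i in atTop, lam * (k i : ℝ) ≤ k (i + 1))

include hk1 hlam hk

theorem summable_inv : Summable fun i => (k i : ℝ)⁻¹ := by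
  have hpos : ∀ i, (0 : ℝ) < k i := fun i => Nat.cast_pos.2 (hk1 i)
  have hl : 0 < lam := by linarith
  refine summable_of_ratio_norm_eventually_le (inv_lt_one_of_one_lt₀ hlam) ?_
  filter_upwards [hk] with i hi
  rw [Real.norm_of_nonneg (inv_nonneg.2 (hpos _).le),
    Real.norm_of_nonneg (inv_nonneg.2 (hpos _).le), ← mul_inv]
  exact inv_anti₀ (mul_pos hl (hpos i)) hi

theorem tendsto_atTop_of_growth : Tendsto (fun i => (k i : ℝ)) atTop atTop := by
  have h := (summable_inv hk1 hlam hk).tendsto_atTop_zero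
  have h2 : Tendsto (fun i => (k i : ℝ)⁻¹) atTop (nhdsWithin 0 (Set.Ioi 0)) :=
    tendsto_nhdsWithin_iff.2 ⟨h, Eventually.of_forall fun i =>
      Set.mem_Ioi.2 (inv_pos.2 (Nat.cast_pos.2 (hk1 i)))⟩
  exact h2.inv_tendsto_nhdsGT_zero.congr fun i => inv_inv _

/-- The ratios `u` of consecutive lengths satisfy `u (i + 2) ≤ 1 / k (i + 1) + u i / lam`. -/
theorem summable_height_ratio :
    Summable fun i => (height k i : ℝ) / height k (i + 1) := by
  have hpos : ∀ i, (0 : ℝ) < k i := fun i => Nat.cast_pos.2 (hk1 i)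
  have hl : 0 < lam := by linarith
  have hh := height_pos k
  obtain ⟨I, hI⟩ := eventually_atTop.1 hk
  set u : ℕ → ℝ := fun i => (height k i : ℝ) / height k (i + 1) with hu
  have hu0 : ∀ i, 0 ≤ u i := fun i => (div_pos (hh _) (hh _)).le
  have hrec : ∀ i ≥ I, u (i + 2) ≤ (k (i + 1) : ℝ)⁻¹ + lam⁻¹ * u i := by
    intro i hi
    have h1 : (height k (i + 2) : ℝ) ≤ height k (i + 1) + k i * height k i := by
      rw [height_add_two]
      linarith [third_le_height_succ k i]
    have h2 : (k (i + 1) : ℝ) * height k (i + 1) ≤ height k (i + 3) := by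
      rw [height_add_two k (i + 1)]
      exact le_add_of_nonneg_left (Nat.cast_nonneg _)
    have hp := mul_pos (hpos (i + 1)) (hh (i + 1))
    calc u (i + 2) ≤ (height k (i + 1) + k i * height k i) / (k (i + 1) * height k (i + 1)) := by
          have := hh i
          have := hpos i
          have := hh (i + 1)
          exact div_le_div₀ (by positivity) h1 hp h2
      _ = (k (i + 1) : ℝ)⁻¹ + (k i / k (i + 1)) * u i := by
          have := (hh i).ne'
          have := (hh (i + 1)).ne'
          have := (hpos (i + 1)).ne'
          simp only [hu]
          field_simp
      _ ≤ _ := by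
          gcongr
          · rw [div_le_iff₀ (hpos _), ← div_eq_inv_mul, le_div_iff₀ hl, mul_comm]
            exact hI i hi
  have hs := (summable_nat_add_iff (I + 1)).2 (summable_inv hk1 hlam hk)
  rw [← summable_nat_add_iff I]
  -- The recursion bounds the partial sums `S n` by `S n ≤ u I + u (I + 1) + E + S n / lam`,
  -- where `E` is the sum of the `1 / k`.
  refine summable_of_sum_range_le (c := (u I + u (I + 1) + ∑' i, (k (i + (I + 1)) : ℝ)⁻¹) /
    (1 - lam⁻¹)) (fun i => hu0 _) fun n => ?_
  have hl1 : 0 < 1 - lam⁻¹ := by linarith [inv_lt_one_of_one_lt₀ hlam]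
  rw [le_div_iff₀ hl1]
  have e1 : ∑ i ∈ Finset.range n, u (i + I) ≤ ∑ i ∈ Finset.range (n + 2), u (i + I) :=
    Finset.sum_le_sum_of_subset_of_nonneg (Finset.range_mono (by omega)) fun i _ _ => hu0 _
  rw [Finset.sum_range_succ', Finset.sum_range_succ'] at e1
  have e2 : ∑ i ∈ Finset.range n, u (i + 1 + 1 + I) ≤
      ∑ i ∈ Finset.range n, ((k (i + (I + 1)) : ℝ)⁻¹ + lam⁻¹ * u (i + I)) := by
    refine Finset.sum_le_sum fun i _ => ?_
    have := hrec (i + I) (by omega)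
    rwa [show i + I + 2 = i + 1 + 1 + I by ring, show i + I + 1 = i + (I + 1) by ring] at this
  rw [Finset.sum_add_distrib, ← Finset.mul_sum] at e2
  have e3 := hs.sum_le_tsum (Finset.range n) fun i _ => inv_nonneg.2 (hpos _).le
  simp only [zero_add, add_comm 1 I] at e1
  linarith

end Growth

/-! ### Two different limits of the frequencies -/

/-- The substitution steps are invertible over the reals. -/
theorem exists_substSeq_eq {k : ℕ → ℕ} (hk1 : ∀ i, 1 ≤ k i) (i : ℕ) (t : ℝ × ℝ × ℝ) :
    ∃ w, substSeq k w i = t := by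
  induction i generalizing t with
  | zero => exact ⟨t, rfl⟩
  | succ i ih =>
    obtain ⟨a, b, c⟩ := t
    obtain ⟨w, hw⟩ := ih (b - c, a, b - k i * (b - c))
    refine ⟨w, ?_⟩
    simp only [substSeq, hw, substStep, nsmul_eq_mul, Nat.cast_pred (hk1 i)]
    ext <;> ring

/-- The proportion of the first orbit segment at level `i` that `w` counts. -/
noncomputable def freq (k : ℕ → ℕ) (w : ℝ × ℝ × ℝ) (i : ℕ) : ℝ :=
  (substSeq k w i).1 / height k i

section Drift

variable {k : ℕ → ℕ} {w : ℝ × ℝ × ℝ} {I : ℕ} (hw : substSeq k w I = ((height k I : ℝ), 0, 0))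
include hw

theorem substSeq_bounds (n : ℕ) :
    (0 ≤ (substSeq k w (I + n)).1 ∧ (substSeq k w (I + n)).1 ≤ height k (I + n)) ∧
    (0 ≤ (substSeq k w (I + n)).2.1 ∧
      (substSeq k w (I + n)).2.1 ≤ (substSeq k ((1 : ℕ), (1 : ℕ), (1 : ℕ)) (I + n)).2.1) ∧
    (0 ≤ (substSeq k w (I + n)).2.2 ∧
      (substSeq k w (I + n)).2.2 ≤ (substSeq k ((1 : ℕ), (1 : ℕ), (1 : ℕ)) (I + n)).2.2) := by
  induction n with
  | zero => simp [hw]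
  | succ n ih =>
    obtain ⟨⟨a0, a1⟩, ⟨b0, b1⟩, c0, c1⟩ := ih
    rw [height] at a1
    rw [← add_assoc]
    generalize I + n = m at *
    simp only [height, substSeq, substStep, nsmul_eq_mul, smul_eq_mul, Nat.cast_add,
      Nat.cast_mul]
    exact ⟨⟨b0, b1⟩, ⟨by positivity, by gcongr⟩, by positivity, by gcongr⟩

theorem abs_freq_add_two_sub_le (n : ℕ) :
    |freq k w (I + n + 2) - freq k w (I + n)| ≤
      (height k (I + n + 1) : ℝ) / height k (I + n + 2) := by
  obtain ⟨⟨a0, a1⟩, -, c0, c1⟩ := substSeq_bounds hw n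
  have h0 := height_pos k (I + n)
  have h2 := height_pos k (I + n + 2)
  have hc := third_le_height_succ k (I + n)
  have e := height_add_two k (I + n)
  have e' : (substSeq k w (I + n + 2)).1 =
      (substSeq k w (I + n)).2.2 + k (I + n) * (substSeq k w (I + n)).1 := by
    simp [substSeq, substStep]
  have hp0 : 0 ≤ freq k w (I + n) := div_nonneg a0 h0.le
  have hp1 : freq k w (I + n) ≤ 1 := (div_le_one h0).2 a1
  have hp : (substSeq k w (I + n)).1 = freq k w (I + n) * height k (I + n) :=
    (div_mul_cancel₀ _ h0.ne').symm
  set p := freq k w (I + n)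
  set c := ((substSeq k ((1 : ℕ), (1 : ℕ), (1 : ℕ)) (I + n)).2.2 : ℝ)
  have key : freq k w (I + n + 2) - p =
      ((substSeq k w (I + n)).2.2 - p * c) / height k (I + n + 2) := by
    rw [freq, e', hp, eq_div_iff h2.ne', sub_mul, div_mul_cancel₀ _ h2.ne', e]
    ring
  rw [key, abs_div, abs_of_pos h2]
  gcongr
  have hc0 : 0 ≤ c := Nat.cast_nonneg _
  rw [abs_le]
  constructor <;> nlinarith

/-- The frequencies at the levels `I, I + 2, …` stay near the initial value `1`, and those at the
levels `I + 1, I + 3, …` stay near the initial value `0`. -/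
theorem freq_bounds (n : ℕ) :
    1 - ∑ j ∈ Finset.range (2 * n + 1), (height k (I + j) : ℝ) / height k (I + j + 1) ≤
        freq k w (I + 2 * n) ∧
      freq k w (I + (2 * n + 1)) ≤
        ∑ j ∈ Finset.range (2 * n + 1), (height k (I + j) : ℝ) / height k (I + j + 1) := by
  have hpos : ∀ i, 0 ≤ (height k (I + i) : ℝ) / height k (I + i + 1) := fun i =>
    (div_pos (height_pos k _) (height_pos k _)).le
  induction n with
  | zero =>
    have h0 := height_pos k I
    have : freq k w (I + 1) = 0 := by simp [freq, substSeq, hw, substStep]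
    have h1 : freq k w I = 1 := by simp only [freq, hw]; exact div_self h0.ne'
    have := hpos 0
    simp_all
  | succ n ih =>
    obtain ⟨h1, h2⟩ := ih
    have d1 := (abs_le.1 (abs_freq_add_two_sub_le hw (2 * n))).1
    have d2 := (abs_le.1 (abs_freq_add_two_sub_le hw (2 * n + 1))).2
    have q1 := hpos (2 * n + 1)
    have q2 := hpos (2 * n + 2)
    rw [show 2 * (n + 1) + 1 = 2 * n + 1 + 1 + 1 by ring, Finset.sum_range_succ,
      Finset.sum_range_succ, show 2 * (n + 1) = 2 * n + 2 by ring]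
    simp only [← add_assoc] at *
    constructor <;> linarith

end Drift

/-- Under exponential growth of `k` some weights have frequencies with different limit points along
the even and the odd levels. -/
theorem exists_freq_gap {k : ℕ → ℕ} (hk1 : ∀ i, 1 ≤ k i) {lam : ℝ} (hlam : 1 < lam)
    (hk : ∀ᶠ i in atTop, lam * (k i : ℝ) ≤ k (i + 1)) :
    ∃ (w : ℝ × ℝ × ℝ) (I : ℕ), ∀ n,
      2 / 3 ≤ freq k w (I + 2 * n) ∧ freq k w (I + (2 * n + 1)) ≤ 1 / 3 := by
  set u : ℕ → ℝ := fun i => (height k i : ℝ) / height k (i + 1)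
  have hs : Summable u := summable_height_ratio hk1 hlam hk
  obtain ⟨I, hI⟩ := ((tendsto_sum_nat_add u).eventually_lt_const
    (show (0 : ℝ) < 1 / 3 by norm_num)).exists
  obtain ⟨w, hw⟩ := exists_substSeq_eq hk1 I (height k I, 0, 0)
  refine ⟨w, I, fun n => ?_⟩
  obtain ⟨h1, h2⟩ := freq_bounds hw n
  have h3 : ∑ j ∈ Finset.range (2 * n + 1), u (I + j) ≤ ∑' j, u (j + I) := by
    simp only [add_comm I]
    exact ((summable_nat_add_iff I).2 hs).sum_le_tsum _ fun i _ =>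
      (div_pos (height_pos k _) (height_pos k _)).le
  constructor <;> linarith

/-! ### Orbits visit short intervals rarely -/

theorem finite_displacements (α β : ℝ) (n : ℕ) :
    (Set.range fun x => (mapReal α β)^[n] x - x).Finite := by
  induction n with
  | zero => simp
  | succ n ih =>
    refine (ih.image2 (· + ·) (Set.toFinite {α, β, β - 1})).subset ?_
    rintro _ ⟨x, rfl⟩
    refine ⟨_, ⟨mapReal α β x, rfl⟩, mapReal α β x - x, ?_, ?_⟩
    · unfold mapReal
      split_ifs
      · left; ring
      · right; left; ring
      · right; right; simp only [Set.mem_singleton_iff]; ring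
    · simp

theorem exists_displacement_bound {α β : ℝ}
    (hper : ∀ x ∈ Set.Ico (0 : ℝ) 1, ∀ n, 0 < n → (mapReal α β)^[n] x ≠ x) (N : ℕ) :
    ∃ ε > 0, ∀ n, 0 < n → n ≤ N → ∀ x ∈ Set.Ico (0 : ℝ) 1,
      ε ≤ |(mapReal α β)^[n] x - x| := by
  induction N with
  | zero => exact ⟨1, one_pos, fun n h1 h2 => by omega⟩
  | succ N ih =>
    obtain ⟨ε, hε, h⟩ := ih
    have hfin : ((fun x => (mapReal α β)^[N + 1] x - x) '' Set.Ico (0 : ℝ) 1).Finite :=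
      (finite_displacements α β (N + 1)).subset (Set.image_subset_range _ _)
    have h0 : (0 : ℝ) ∈ ((fun x => (mapReal α β)^[N + 1] x - x) '' Set.Ico (0 : ℝ) 1)ᶜ := by
      rintro ⟨x, hx, hx0⟩
      exact hper x hx _ N.succ_pos (sub_eq_zero.1 hx0)
    obtain ⟨δ, hδ, hball⟩ := Metric.isOpen_iff.1 hfin.isClosed.isOpen_compl 0 h0
    refine ⟨min ε δ, lt_min hε hδ, fun n hn hnN x hx => ?_⟩
    rcases hnN.lt_or_eq with hlt | rfl
    · exact (min_le_left _ _).trans (h n hn (by omega) x hx)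
    · refine (min_le_right _ _).trans (not_lt.1 fun hc => ?_)
      have hmem : (mapReal α β)^[N + 1] x - x ∈ Metric.ball (0 : ℝ) δ := by
        rwa [Metric.mem_ball, dist_zero_right, Real.norm_eq_abs]
      exact hball hmem ⟨x, hx, rfl⟩

/-- Two visits to a short interval are far apart in time. -/
theorem birkhoffSum_short_le {f : ℝ → ℝ} {I : Set ℝ} (hf : Set.MapsTo f I I) {N : ℕ}
    (hN : 0 < N) {ε : ℝ} (h : ∀ n, 0 < n → n ≤ N → ∀ x ∈ I, ε ≤ |f^[n] x - x|) (a : ℝ) (L : ℕ)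
    {x : ℝ} (hx : x ∈ I) :
    birkhoffSum f ((Set.Ico a (a + ε)).indicator (1 : ℝ → ℝ)) L x ≤ L / N + 1 := by
  set g : ℝ → ℝ := (Set.Ico a (a + ε)).indicator 1 with hg
  have hg0 : ∀ y, 0 ≤ g y := Set.indicator_nonneg fun _ _ => zero_le_one
  have hone : ∀ x ∈ I, birkhoffSum f g N x ≤ 1 := by
    intro x hx
    rw [birkhoffSum]
    simp only [hg, Set.indicator_apply, Pi.one_apply, Finset.sum_boole]
    refine Nat.cast_le_one.2 (Finset.card_le_one.2 ?_)
    have key : ∀ m n, m < n → n < N → f^[m] x ∈ Set.Ico a (a + ε) →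
        f^[n] x ∉ Set.Ico a (a + ε) := by
      rintro m n hmn hn ⟨m1, m2⟩ ⟨n1, n2⟩
      have := h (n - m) (by omega) (by omega) (f^[m] x) (hf.iterate m hx)
      rw [← Function.iterate_add_apply, Nat.sub_add_cancel hmn.le] at this
      exact not_lt.2 this (abs_sub_lt_iff.2 ⟨by linarith, by linarith⟩)
    intro m hm n hn
    simp only [Finset.mem_filter, Finset.mem_range] at hm hn
    rcases lt_trichotomy m n with hlt | heq | hlt
    · exact absurd hn.2 (key m n hlt hn.1 hm.2)
    · exact heq
    · exact absurd hm.2 (key n m hlt hm.1 hn.2)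
  have hmul : ∀ q : ℕ, birkhoffSum f g (q * N) x ≤ q := by
    intro q
    induction q with
    | zero => simp
    | succ q ih =>
      rw [Nat.succ_mul, birkhoffSum_add, Nat.cast_succ]
      exact add_le_add ih (hone _ (hf.iterate _ hx))
  have hle : L ≤ (L / N + 1) * N := by
    rw [mul_comm]; exact (Nat.lt_mul_div_succ L hN).le
  calc birkhoffSum f g L x ≤ birkhoffSum f g ((L / N + 1) * N) x :=
        Finset.sum_le_sum_of_subset_of_nonneg (Finset.range_mono hle) fun i _ _ => hg0 _
    _ ≤ ((L / N + 1 : ℕ) : ℝ) := hmul _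
    _ ≤ L / N + 1 := by push_cast; gcongr; exact Nat.cast_div_le

/-! ### Invariant means and invariant measures -/

/-- A finitely additive probability on all sets of reals, concentrated on `[0, 1)`, invariant
under `f`, and uniformly small on short intervals. -/
structure IsInvariantMean (f : ℝ → ℝ) (m : Set ℝ → ℝ) : Prop where
  nonneg : ∀ E, 0 ≤ m E
  total : m (Set.Ico 0 1) = 1
  inter : ∀ E, m (E ∩ Set.Ico 0 1) = m E
  union : ∀ E E', Disjoint E E' → m (E ∪ E') = m E + m E'
  preimage : ∀ E, m (f ⁻¹' E) = m E
  small : ∀ δ > 0, ∃ ε > 0, ∀ a, m (Set.Ico a (a + ε)) ≤ δ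

/-- Limits of Birkhoff averages along an ultrafilter form an invariant mean. -/
theorem exists_isInvariantMean {α β : ℝ} (h : IsParam α β)
    (hper : ∀ x ∈ Set.Ico (0 : ℝ) 1, ∀ n, 0 < n → (mapReal α β)^[n] x ≠ x)
    {x : ℕ → ℝ} (hx : ∀ n, x n ∈ Set.Ico (0 : ℝ) 1) {L : ℕ → ℕ} (hL : Tendsto L atTop atTop) :
    ∃ m, IsInvariantMean (mapReal α β) m ∧ ∀ E, Tendsto
      (fun n => birkhoffAverage ℝ (mapReal α β) (Set.indicator E (1 : ℝ → ℝ)) (L n) (x n))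
      (hyperfilter ℕ) (nhds (m E)) := by
  set f := mapReal α β with hf
  have hI : ∀ n j, f^[j] (x n) ∈ Set.Ico (0 : ℝ) 1 := fun n j =>
    (mapsTo_mapReal h).iterate j (hx n)
  set A : Set ℝ → ℕ → ℝ := fun E n =>
    birkhoffAverage ℝ f (E.indicator (1 : ℝ → ℝ)) (L n) (x n) with hA
  have hA_eq : ∀ E n, A E n = (L n : ℝ)⁻¹ * birkhoffSum f (E.indicator (1 : ℝ → ℝ)) (L n) (x n) :=
    fun E n => rfl
  have hA0 : ∀ E n, 0 ≤ A E n := fun E n =>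
    mul_nonneg (inv_nonneg.2 (Nat.cast_nonneg _))
      (Finset.sum_nonneg fun _ _ => Set.indicator_nonneg (fun _ _ => zero_le_one) _)
  have hA1 : ∀ E n, A E n ≤ 1 := by
    intro E n
    have : birkhoffSum f (E.indicator (1 : ℝ → ℝ)) (L n) (x n) ≤ L n := by
      refine (Finset.sum_le_card_nsmul _ _ 1 fun i _ => ?_).trans (by simp)
      exact Set.indicator_le_self' (fun _ _ => zero_le_one) _
    rw [hA_eq]
    exact inv_mul_le_one_of_le₀ this (Nat.cast_nonneg _)
  have hlim : ∀ E, ∃ y, Tendsto (A E) (hyperfilter ℕ) (nhds y) := by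
    intro E
    obtain ⟨y, -, hy⟩ := (isCompact_Icc (a := (0 : ℝ)) (b := 1)).ultrafilter_le_nhds
      ((hyperfilter ℕ).map (A E)) (by
        rw [le_principal_iff]
        exact Filter.mem_map.2 (Filter.univ_mem' fun n => ⟨hA0 E n, hA1 E n⟩))
    exact ⟨y, hy⟩
  choose m hm using hlim
  have hLtop : Tendsto L (hyperfilter ℕ) atTop := hL.mono_left Nat.hyperfilter_le_atTop
  have hLinv : Tendsto (fun n => (L n : ℝ)⁻¹) (hyperfilter ℕ) (nhds 0) :=
    tendsto_inv_atTop_zero.comp (tendsto_natCast_atTop_atTop.comp hLtop)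
  refine ⟨m, ⟨?_, ?_, ?_, ?_, ?_, ?_⟩, hm⟩
  · exact fun E => ge_of_tendsto' (hm E) (hA0 E)
  · refine tendsto_nhds_unique (hm _) (tendsto_const_nhds.congr' ?_)
    filter_upwards [hLtop.eventually_ge_atTop 1] with n hn
    have : birkhoffSum f ((Set.Ico (0 : ℝ) 1).indicator (1 : ℝ → ℝ)) (L n) (x n) = L n := by
      simp [birkhoffSum, Set.indicator_of_mem (hI n _)]
    rw [hA_eq, this, inv_mul_cancel₀]
    exact Nat.cast_ne_zero.2 (by omega)
  · intro E
    refine tendsto_nhds_unique (hm _) ((hm E).congr fun n => ?_)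
    rw [hA_eq, hA_eq]
    congr 1
    refine Finset.sum_congr rfl fun j _ => ?_
    classical simp only [Set.indicator_apply, Set.mem_inter_iff, hI n j, and_true]
  · intro E E' hd
    refine tendsto_nhds_unique (hm _) (((hm E).add (hm E')).congr fun n => ?_)
    rw [hA_eq, hA_eq, hA_eq, ← mul_add, Set.indicator_union_of_disjoint hd]
    congr 1
    exact (Finset.sum_add_distrib).symm
  · intro E
    refine tendsto_nhds_unique (hm _) ?_
    have hz : Tendsto (fun n => A (f ⁻¹' E) n - A E n) (hyperfilter ℕ) (nhds 0) := by
      refine squeeze_zero_norm (fun n => ?_) hLinv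
      have e : birkhoffSum f ((f ⁻¹' E).indicator (1 : ℝ → ℝ)) (L n) (x n) =
          birkhoffSum f (E.indicator (1 : ℝ → ℝ)) (L n) (f (x n)) := by
        refine Finset.sum_congr rfl fun j _ => ?_
        rw [← Function.iterate_succ_apply, Function.iterate_succ_apply']
        rfl
      rw [hA_eq, hA_eq, e, ← mul_sub, birkhoffSum_apply_sub_birkhoffSum, norm_mul,
        Real.norm_of_nonneg (inv_nonneg.2 (Nat.cast_nonneg _))]
      refine mul_le_of_le_one_right (inv_nonneg.2 (Nat.cast_nonneg _)) ?_
      rw [Real.norm_eq_abs, abs_le]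
      classical
      simp only [Set.indicator_apply, Pi.one_apply]
      split_ifs <;> norm_num
    simpa using hz.add (hm E)
  · intro δ hδ
    obtain ⟨N, hN⟩ := exists_nat_gt (1 / δ)
    have hN0 : (0 : ℝ) < N := lt_trans (by positivity) hN
    obtain ⟨ε, hε, hsp⟩ := exists_displacement_bound hper N
    refine ⟨ε, hε, fun a => ?_⟩
    have hlim : Tendsto (fun n => (N : ℝ)⁻¹ + (L n : ℝ)⁻¹) (hyperfilter ℕ)
        (nhds ((N : ℝ)⁻¹ + 0)) := tendsto_const_nhds.add hLinv
    refine (le_of_tendsto_of_tendsto (hm _) hlim ?_).trans ?_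
    · filter_upwards [hLtop.eventually_ge_atTop 1] with n hn
      have hLn : (0 : ℝ) < L n := Nat.cast_pos.2 hn
      have := birkhoffSum_short_le (mapsTo_mapReal h) (Nat.cast_pos.1 hN0) hsp a (L n) (hx n)
      calc A (Set.Ico a (a + ε)) n ≤ (L n : ℝ)⁻¹ * (L n / N + 1) := by
            rw [hA_eq]; gcongr
        _ = _ := by field_simp
    · rw [add_zero, inv_le_comm₀ hN0 hδ, ← one_div]
      exact hN.le

namespace IsInvariantMean

variable {f : ℝ → ℝ} {m : Set ℝ → ℝ} (hm : IsInvariantMean f m)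
include hm

theorem empty : m ∅ = 0 := by
  have := hm.union ∅ ∅ (Set.disjoint_empty _)
  rw [Set.union_empty] at this
  linarith

theorem mono {E E' : Set ℝ} (h : E ⊆ E') : m E ≤ m E' := by
  have := hm.union E (E' \ E) Set.disjoint_sdiff_right
  rw [Set.union_sdiff_cancel h] at this
  linarith [hm.nonneg (E' \ E)]

theorem Iio_add_Ico {a b : ℝ} (h : a ≤ b) : m (Set.Iio a) + m (Set.Ico a b) = m (Set.Iio b) := by
  rw [← hm.union (Set.Iio a) (Set.Ico a b)
    (Set.disjoint_left.2 fun x hx hx' => not_lt.2 hx'.1 hx), Set.Iio_union_Ico_eq_Iio h]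

theorem continuous_Iio : Continuous fun x => m (Set.Iio x) := by
  rw [Metric.continuous_iff]
  intro x δ hδ
  obtain ⟨ε, hε, h⟩ := hm.small (δ / 2) (by positivity)
  refine ⟨ε, hε, fun y hy => ?_⟩
  rw [Real.dist_eq] at hy ⊢
  obtain ⟨h1, h2⟩ := abs_lt.1 hy
  rcases le_total x y with hxy | hxy
  · have e := hm.Iio_add_Ico hxy
    have := (hm.mono (Set.Ico_subset_Ico_right (by linarith : y ≤ x + ε))).trans (h x)
    rw [abs_of_nonneg (by linarith [hm.nonneg (Set.Ico x y)])]
    linarith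
  · have e := hm.Iio_add_Ico hxy
    have := (hm.mono (Set.Ico_subset_Ico_right (by linarith : x ≤ y + ε))).trans (h y)
    rw [abs_of_nonpos (by linarith [hm.nonneg (Set.Ico y x)])]
    linarith

theorem Iio_of_nonpos {x : ℝ} (hx : x ≤ 0) : m (Set.Iio x) = 0 := by
  rw [← hm.inter, Set.disjoint_iff_inter_eq_empty.1, hm.empty]
  exact Set.disjoint_left.2 fun y h h' => not_lt.2 (hx.trans h'.1) h

theorem Iio_of_one_le {x : ℝ} (hx : 1 ≤ x) : m (Set.Iio x) = 1 := by
  rw [← hm.inter, Set.inter_eq_right.2, hm.total]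
  exact fun y hy => hy.2.trans_le hx

/-- An invariant mean agrees on half-open intervals with a Borel probability measure, whose
distribution function is continuous because the mean is uniformly small on short intervals. -/
theorem exists_measure : ∃ μ : Measure ℝ, IsProbabilityMeasure μ ∧
    ∀ a b, μ (Set.Ico a b) = ENNReal.ofReal (m (Set.Ico a b)) := by
  let F : StieltjesFunction ℝ :=
    { toFun := fun x => m (Set.Iio x)
      mono' := fun x y h => hm.mono (Set.Iio_subset_Iio h)
      right_continuous' := fun x => hm.continuous_Iio.continuousWithinAt }
  have hbot : Tendsto F atBot (nhds 0) :=
    tendsto_const_nhds.congr' (by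
      filter_upwards [eventually_le_atBot 0] with x hx using (hm.Iio_of_nonpos hx).symm)
  have htop : Tendsto F atTop (nhds 1) :=
    tendsto_const_nhds.congr' (by
      filter_upwards [eventually_ge_atTop 1] with x hx using (hm.Iio_of_one_le hx).symm)
  have hleft : ∀ x, Function.leftLim F x = F x := fun x =>
    hm.continuous_Iio.continuousWithinAt.leftLim_eq
  refine ⟨F.measure, ⟨by simp [F.measure_univ hbot htop]⟩, fun a b => ?_⟩
  rw [F.measure_Ico, hleft, hleft]
  rcases le_or_gt a b with hab | hab
  · congr 1
    exact sub_eq_iff_eq_add'.2 (hm.Iio_add_Ico hab).symm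
  · rw [Set.Ico_eq_empty (not_lt.2 hab.le), hm.empty, ENNReal.ofReal_zero,
      ENNReal.ofReal_eq_zero]
    exact sub_nonpos.2 (F.mono hab.le)

end IsInvariantMean

theorem measurable_mapReal (α β : ℝ) : Measurable (mapReal α β) := by
  unfold mapReal
  refine Measurable.ite measurableSet_Iio (by fun_prop) (Measurable.ite measurableSet_Iio
    (by fun_prop) (by fun_prop))

/-- The preimage of a half-line consists of one interval in each interval of continuity. -/
theorem preimage_Ici_inter {α β : ℝ} (h : IsParam α β) (t : ℝ) :
    mapReal α β ⁻¹' Set.Ici t ∩ Set.Ico 0 1 = Set.Ico (max 0 (t - α)) (1 - α) ∪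
      (Set.Ico (max (1 - α) (t - β)) (1 - β) ∪ Set.Ico (max (1 - β) (t - β + 1)) 1) := by
  obtain ⟨h1, h2, h3⟩ := h
  ext x
  simp only [Set.mem_inter_iff, Set.mem_preimage, Set.mem_Ici, Set.mem_Ico, Set.mem_union,
    max_le_iff, mapReal]
  split_ifs with ha hb
  · constructor
    · rintro ⟨p, q, r⟩
      exact Or.inl ⟨⟨q, by linarith⟩, ha⟩
    · rintro (⟨⟨p, q⟩, r⟩ | ⟨⟨p, q⟩, r⟩ | ⟨⟨p, q⟩, r⟩)
      · exact ⟨by linarith, p, by linarith⟩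
      · linarith
      · linarith
  · constructor
    · rintro ⟨p, q, r⟩
      exact Or.inr (Or.inl ⟨⟨by linarith, by linarith⟩, hb⟩)
    · rintro (⟨⟨p, q⟩, r⟩ | ⟨⟨p, q⟩, r⟩ | ⟨⟨p, q⟩, r⟩)
      · linarith
      · exact ⟨by linarith, by linarith, by linarith⟩
      · linarith
  · constructor
    · rintro ⟨p, q, r⟩
      exact Or.inr (Or.inr ⟨⟨by linarith, by linarith⟩, r⟩)
    · rintro (⟨⟨p, q⟩, r⟩ | ⟨⟨p, q⟩, r⟩ | ⟨⟨p, q⟩, r⟩)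
      · linarith
      · linarith
      · exact ⟨by linarith, by linarith, r⟩

theorem IsInvariantMean.map_eq {α β : ℝ} (h : IsParam α β) {m : Set ℝ → ℝ}
    (hm : IsInvariantMean (mapReal α β) m) {μ : Measure ℝ} [IsProbabilityMeasure μ]
    (hμ : ∀ a b, μ (Set.Ico a b) = ENNReal.ofReal (m (Set.Ico a b))) :
    μ.map (mapReal α β) = μ := by
  have hf := measurable_mapReal α β
  have hI : μ (Set.Ico 0 1) = 1 := by rw [hμ, hm.total, ENNReal.ofReal_one]
  have hinter : ∀ E, μ (E ∩ Set.Ico 0 1) = μ E := fun E =>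
    measure_inter_conull ((prob_compl_eq_zero_iff measurableSet_Ico).2 hI)
  have : IsProbabilityMeasure (μ.map (mapReal α β)) :=
    Measure.isProbabilityMeasure_map hf.aemeasurable
  refine Measure.ext_of_Ici _ _ fun t => ?_
  rw [Measure.map_apply hf measurableSet_Ici, ← hinter, ← hinter (Set.Ici t)]
  have e2 : Set.Ici t ∩ Set.Ico (0 : ℝ) 1 = Set.Ico (max t 0) 1 := by
    ext x; simp [and_assoc]
  have e3 : m (Set.Ici t) = m (Set.Ico (max t 0) 1) := by rw [← hm.inter, e2]
  have d1 : Disjoint (Set.Ico (max 0 (t - α)) (1 - α))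
      (Set.Ico (max (1 - α) (t - β)) (1 - β) ∪ Set.Ico (max (1 - β) (t - β + 1)) 1) := by
    rw [Set.disjoint_left]
    rintro x ⟨-, p⟩ (⟨q, -⟩ | ⟨q, -⟩)
    · linarith [le_trans (le_max_left _ _) q]
    · linarith [le_trans (le_max_left _ _) q, h.2.1]
  have d2 : Disjoint (Set.Ico (max (1 - α) (t - β)) (1 - β))
      (Set.Ico (max (1 - β) (t - β + 1)) 1) := by
    rw [Set.disjoint_left]
    rintro x ⟨-, p⟩ ⟨q, -⟩
    linarith [le_trans (le_max_left _ _) q]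
  rw [e2, hμ, ← e3, ← hm.preimage, ← hm.inter, preimage_Ici_inter h, hm.union _ _ d1,
    hm.union _ _ d2, measure_union d1 (measurableSet_Ico.union measurableSet_Ico),
    measure_union d2 measurableSet_Ico, hμ, hμ, hμ,
    ENNReal.ofReal_add (hm.nonneg _) (add_nonneg (hm.nonneg _) (hm.nonneg _)),
    ENNReal.ofReal_add (hm.nonneg _) (hm.nonneg _)]

/-- An invariant mean comes from an invariant Borel probability measure on `[0, 1)`. -/
theorem IsInvariantMean.exists_isInvariantProbability {α β : ℝ} (h : IsParam α β)
    {m : Set ℝ → ℝ} (hm : IsInvariantMean (mapReal α β) m) :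
    ∃ ν : Measure (Set.Ico (0 : ℝ) 1), IsInvariantProbability (T h) ν ∧
      ∀ a b, 0 ≤ a → b ≤ 1 → ν.real ((↑) ⁻¹' Set.Ico a b) = m (Set.Ico a b) := by
  obtain ⟨μ, hμ, hμm⟩ := hm.exists_measure
  have hemb : MeasurableEmbedding ((↑) : Set.Ico (0 : ℝ) 1 → ℝ) :=
    MeasurableEmbedding.subtype_coe measurableSet_Ico
  have hI : μ (Set.Ico 0 1) = 1 := by rw [hμm, hm.total, ENNReal.ofReal_one]
  have hT : Measurable (T h) :=
    ((measurable_mapReal α β).comp measurable_subtype_coe).subtype_mk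
  set ν := μ.comap ((↑) : Set.Ico (0 : ℝ) 1 → ℝ) with hν
  have hmap : ν.map (↑) = μ := by
    rw [hν, hemb.map_comap, Subtype.range_coe,
      Measure.restrict_eq_self_of_ae_mem]
    exact (prob_compl_eq_zero_iff measurableSet_Ico).2 hI
  refine ⟨ν, ⟨⟨?_⟩, hT, ?_⟩, fun a b ha hb => ?_⟩
  · rw [hν, hemb.comap_apply, Set.image_univ, Subtype.range_coe, hI]
  · have e : (ν.map (T h)).map ((↑) : Set.Ico (0 : ℝ) 1 → ℝ) = ν.map (↑) := by
      rw [Measure.map_map hemb.measurable hT]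
      change ν.map (mapReal α β ∘ (↑)) = _
      rw [← Measure.map_map (measurable_mapReal α β) hemb.measurable, hmap, hm.map_eq h hμm]
    rw [← hemb.comap_map (ν.map (T h)), e, hemb.comap_map]
  · rw [measureReal_def, hν, hemb.comap_apply, Subtype.image_preimage_coe,
      Set.inter_eq_right.2 (Set.Ico_subset_Ico ha hb), hμm, ENNReal.toReal_ofReal (hm.nonneg _)]

/-! ### Two invariant measures -/

theorem piece_eq_indicator {α β : ℝ} (h : IsParam α β) (w : ℝ × ℝ × ℝ) {y : ℝ}
    (hy : y ∈ Set.Ico (0 : ℝ) 1) :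
    piece α β w y = w.1 * (Set.Ico 0 (1 - α)).indicator 1 y +
      w.2.1 * (Set.Ico (1 - α) (1 - β)).indicator 1 y +
      w.2.2 * (Set.Ico (1 - β) 1).indicator 1 y := by
  obtain ⟨h1, h2, h3⟩ := h
  obtain ⟨hy0, hy1⟩ := hy
  unfold piece
  simp only [Set.indicator_apply, Set.mem_Ico, Pi.one_apply]
  split_ifs <;> grind

theorem birkhoffAverage_piece {α β : ℝ} (h : IsParam α β) (w : ℝ × ℝ × ℝ) (n : ℕ) {x : ℝ}
    (hx : x ∈ Set.Ico (0 : ℝ) 1) :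
    birkhoffAverage ℝ (mapReal α β) (piece α β w) n x =
      w.1 * birkhoffAverage ℝ (mapReal α β) ((Set.Ico 0 (1 - α)).indicator (1 : ℝ → ℝ)) n x +
      w.2.1 * birkhoffAverage ℝ (mapReal α β)
        ((Set.Ico (1 - α) (1 - β)).indicator (1 : ℝ → ℝ)) n x +
      w.2.2 * birkhoffAverage ℝ (mapReal α β) ((Set.Ico (1 - β) 1).indicator (1 : ℝ → ℝ)) n x := by
  have : birkhoffSum (mapReal α β) (piece α β w) n x =
      w.1 * birkhoffSum (mapReal α β) ((Set.Ico 0 (1 - α)).indicator (1 : ℝ → ℝ)) n x +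
      w.2.1 * birkhoffSum (mapReal α β)
        ((Set.Ico (1 - α) (1 - β)).indicator (1 : ℝ → ℝ)) n x +
      w.2.2 * birkhoffSum (mapReal α β) ((Set.Ico (1 - β) 1).indicator (1 : ℝ → ℝ)) n x := by
    simp only [birkhoffSum, Finset.mul_sum, ← Finset.sum_add_distrib]
    exact Finset.sum_congr rfl fun j _ =>
      piece_eq_indicator h w ((mapsTo_mapReal h).iterate j hx)
  simp only [birkhoffAverage, smul_eq_mul, this]
  ring

/-- The integral of `piece α β w` with respect to `ν`. -/
noncomputable def weight (α β : ℝ) (w : ℝ × ℝ × ℝ) (ν : Measure (Set.Ico (0 : ℝ) 1)) : ℝ :=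
  w.1 * ν.real ((↑) ⁻¹' Set.Ico 0 (1 - α)) + w.2.1 * ν.real ((↑) ⁻¹' Set.Ico (1 - α) (1 - β)) +
    w.2.2 * ν.real ((↑) ⁻¹' Set.Ico (1 - β) 1)

/-- The left end points of the renormalization segments begin orbit segments along which the
Birkhoff averages of `piece α β w` are the frequencies. -/
theorem birkhoffAverage_piece_zoom {α β : ℝ}
    (hP : ∀ i, IsParam (gauss^[i] (α, β)).1 (gauss^[i] (α, β)).2) (w : ℝ × ℝ × ℝ) (i : ℕ) :
    birkhoffAverage ℝ (mapReal α β) (piece α β w) (height (coding α β) i)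
      (zoom (scale α β i) 0) = freq (coding α β) w i := by
  have h0 : (0 : ℝ) < 1 - (gauss^[i] (α, β)).1 := by linarith [(hP i).2.2]
  have h := (isTower_scale hP w i 0 ⟨le_rfl, one_pos⟩).2
  simp only [piece, if_pos h0] at h
  rw [birkhoffAverage, freq, div_eq_inv_mul, smul_eq_mul, ← h]
  rfl

/-- Limits of frequencies are realized by invariant measures. -/
theorem exists_weight_limit {α β : ℝ}
    (hP : ∀ i, IsParam (gauss^[i] (α, β)).1 (gauss^[i] (α, β)).2) (h : IsParam α β)
    (hk : Tendsto (fun i => (coding α β i : ℝ)) atTop atTop) (w : ℝ × ℝ × ℝ) {s : ℕ → ℕ}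
    (hs : Tendsto s atTop atTop) :
    ∃ ν, IsInvariantProbability (T h) ν ∧
      Tendsto (fun n => freq (coding α β) w (s n)) (hyperfilter ℕ) (nhds (weight α β w ν)) := by
  have hx : ∀ n, zoom (scale α β (s n)) 0 ∈ Set.Ico (0 : ℝ) 1 := fun n =>
    zoom_mem (scale_mem hP _).1 (scale_mem hP _).2 ⟨le_rfl, one_pos⟩
  obtain ⟨m, hm, hlim⟩ := exists_isInvariantMean h
    (fun x hx n hn => iterate_ne_self hP hk hx hn) hx ((tendsto_height hk).comp hs)
  obtain ⟨ν, hν, hνm⟩ := hm.exists_isInvariantProbability h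
  refine ⟨ν, hν, ?_⟩
  obtain ⟨h1, h2, h3⟩ := id h
  rw [weight, hνm _ _ le_rfl (by linarith), hνm _ _ (by linarith) (by linarith),
    hνm _ _ (by linarith) le_rfl]
  refine ((((hlim _).const_mul w.1).add ((hlim _).const_mul w.2.1)).add
    ((hlim _).const_mul w.2.2)).congr fun n => ?_
  rw [← birkhoffAverage_piece_zoom hP, birkhoffAverage_piece h w _ (hx n)]
  rfl

end ITM

theorem theorem2p11 (α β : ℝ) (h : ITM.IsParam α β) (hinf : ITM.InfiniteType (ITM.T h))
    (lam : ℝ) (hlam : 1 < lam)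
    (hk : ∀ᶠ i : ℕ in atTop,
      lam * (ITM.coding α β i : ℝ) ≤ (ITM.coding α β (i + 1) : ℝ)) :
    (∃ μ : Measure (Set.Ico (0 : ℝ) 1), ITM.IsInvariantProbability (ITM.T h) μ) ∧
      ¬ ITM.UniquelyErgodic (ITM.T h) := by
  have hP := ITM.isParam_iterate_gauss h hinf
  have hk1 := ITM.one_le_coding hP
  have htop := ITM.tendsto_atTop_of_growth hk1 hlam hk
  obtain ⟨w, I, hw⟩ := ITM.exists_freq_gap hk1 hlam hk
  obtain ⟨μ, hμ, hμlim⟩ := ITM.exists_weight_limit hP h htop w (s := fun n => I + 2 * n)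
    (tendsto_atTop_mono (fun n => show n ≤ I + 2 * n by omega) tendsto_id)
  obtain ⟨ν, hν, hνlim⟩ := ITM.exists_weight_limit hP h htop w (s := fun n => I + (2 * n + 1))
    (tendsto_atTop_mono (fun n => show n ≤ I + (2 * n + 1) by omega) tendsto_id)
  refine ⟨⟨μ, hμ⟩, fun hu => ?_⟩
  have h1 := ge_of_tendsto' hμlim fun n => (hw n).1
  have h2 := le_of_tendsto' hνlim fun n => (hw n).2
  rw [hu.unique hμ hν] at h1
  linarith
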